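/- Let $p>2$ be a prime number and let $G\neq\{e\}$ be a finite $p$-group. For a finite $p$-group $H$ define the breadth of $h\in H$ by $b(h):=\log_p|H:Z_H(h)|$, where $Z_H(h)$ is the centralizer of $h$ in $H$, let $b(H):=\max_{h\in H}b(h)$ be the breadth of $H$, and let $cl(H)$ denote the nilpotency class of $H$. Then there exists a characteristic subgroup $N$ of $G$ such that: 1. $\log_2|G:N|\leq (b(G)+2)\,f^{\,b(G)+1}\big(b(G)\log_2 p\big)$, where $f^k$ is the $k$-th iteration of the function $f(x)=x(x+1)$; 2. $cl(N)\leq b(N)+1$, where $b(N)$ is the breadth of $N$ as a group in its own right. -/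

import Mathlib

/-- The breadth `b(g) = log_p |G : Z_G(g)|` of an element `g` of a finite `p`-group `G`.
The index of the centralizer is then a power of `p`, so the integer logarithm is exact
(see `pow_elementBreadth`). -/
noncomputable def elementBreadth (p : ℕ) {G : Type*} [Group G] (g : G) : ℕ :=
  Nat.log p (Subgroup.centralizer {g}).index

/-- The breadth `b(G) = max_{g ∈ G} b(g)` of a finite `p`-group `G`
(the maximum is attained, see `exists_elementBreadth_eq_breadth`). -/
noncomputable def breadth (p : ℕ) (G : Type*) [Group G] : ℕ :=
  ⨆ g : G, elementBreadth p g

theorem pow_elementBreadth {p : ℕ} (hp : p.Prime) {G : Type*} [Group G] [Finite G]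
    (hG : IsPGroup p G) (g : G) :
    p ^ elementBreadth p g = (Subgroup.centralizer {g}).index := by
  have : Fact p.Prime := ⟨hp⟩
  obtain ⟨n, hn⟩ := hG.index (Subgroup.centralizer {g})
  rw [elementBreadth, hn, Nat.log_pow hp.one_lt]

theorem exists_elementBreadth_eq_breadth (p : ℕ) (G : Type*) [Group G] [Finite G] :
    (∃ g : G, elementBreadth p g = breadth p G) ∧
      ∀ g : G, elementBreadth p g ≤ breadth p G :=
  ⟨exists_eq_ciSup_of_finite, fun g => le_ciSup (Set.finite_range _).bddAbove g⟩

open Subgroup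
open scoped commutatorElement

/-! Take `N` to be the centralizer of `G'`: its derived subgroup is central, so its class is at most
2. Its index is small because `G'` lies in a subgroup with few generators. Let `g` have maximal
breadth `b`. At most `b` elements `T` generate a group transitive on the class of `g`. If `d`
centralizes `T`, the class of `g` times `d` lies in the class of `g * d`, so equals it by
maximality; this puts every `[y, d]` in `⟨g, T⟩`. As `C(T)` has index at most `p ^ (b ^ 2)`, at most
`b ^ 2` further generators `S` give `G = ⟨g, T, S⟩ C(T)`, whence `G' ≤ ⟨g, T, S⟩`. -/

theorem ncard_conj_eq_index_centralizer {G : Type*} [Group G] (g : G) :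
    (Set.range fun y : G => y * g * y⁻¹).ncard = (centralizer {g}).index := by
  have h : (centralizer {g}).index = (MulAction.stabilizer (ConjAct G) g).index := by
    rw [ConjAct.stabilizer_eq_centralizer]
    rfl
  rw [h, MulAction.index_stabilizer]
  rfl

theorem IsPGroup.mul_index_le_of_lt {p : ℕ} [hp : Fact p.Prime] {G : Type*} [Group G] [Finite G]
    (hG : IsPGroup p G) {C D : Subgroup G} (h : C < D) : p * D.index ≤ C.index := by
  obtain ⟨a, ha⟩ := hG.index C
  obtain ⟨b, hb⟩ := hG.index D
  have hlt := index_strictAnti h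
  rw [ha, hb] at hlt ⊢
  rw [← pow_succ']
  exact Nat.pow_le_pow_right hp.out.pos ((Nat.pow_lt_pow_iff_right hp.out.one_lt).1 hlt)

/-- A subgroup of index `p ^ k` in a finite `p`-group has a complement, in the sense of product
sets, that is generated by at most `k` elements. -/
theorem IsPGroup.exists_finset_closure_mul_eq_univ {p : ℕ} [hp : Fact p.Prime] {G : Type*}
    [Group G] [Finite G] (hG : IsPGroup p G) (C : Subgroup G) :
    ∃ T : Finset G, p ^ T.card ≤ C.index ∧
      ∀ x : G, ∃ h ∈ closure (T : Set G), ∃ c ∈ C, x = h * c := by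
  classical
  have hnil : Group.IsNilpotent G := hG.isNilpotent
  induction C using WellFoundedGT.induction with
  | ind C ih =>
  rcases eq_or_ne C ⊤ with rfl | hC
  · exact ⟨∅, by simp, fun x => ⟨1, one_mem _, x, mem_top x, (one_mul x).symm⟩⟩
  -- Normalizers grow, so adjoining `t` costs one generator, divides the index by at least `p`, and
  -- keeps `⟨t⟩ C` a subgroup.
  obtain ⟨t, htN, htC⟩ := SetLike.exists_of_lt
    (Group.normalizerCondition_of_isNilpotent C hC.lt_top)
  have hle : zpowers t ≤ normalizer (C : Set G) := by rwa [zpowers_le]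
  have hlt : C < zpowers t ⊔ C := lt_of_le_of_ne le_sup_right fun h =>
    htC (h ▸ mem_sup_left (mem_zpowers t))
  obtain ⟨T, hT, hTC⟩ := ih _ hlt
  refine ⟨insert t T, ?_, fun x => ?_⟩
  · calc p ^ (insert t T).card ≤ p ^ (T.card + 1) :=
          Nat.pow_le_pow_right hp.out.pos (Finset.card_insert_le t T)
      _ ≤ p * (zpowers t ⊔ C).index := by
          rw [pow_succ']
          exact Nat.mul_le_mul_left p hT
      _ ≤ C.index := hG.mul_index_le_of_lt hlt
  · obtain ⟨h, hh, c, hc, rfl⟩ := hTC x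
    rw [← SetLike.mem_coe, coe_mul_of_left_le_normalizer_right _ _ hle] at hc
    obtain ⟨u, hu, c, hc, rfl⟩ := hc
    refine ⟨h * u, mul_mem (closure_mono (by simp) hh) ?_, c, hc, (mul_assoc _ _ _).symm⟩
    exact zpowers_le.2 (subset_closure (by simp)) hu

theorem index_centralizer_singleton_le {p : ℕ} (hp : p.Prime) {G : Type*} [Group G] [Finite G]
    (hG : IsPGroup p G) (g : G) : (centralizer {g}).index ≤ p ^ breadth p G := by
  rw [← pow_elementBreadth hp hG]
  exact Nat.pow_le_pow_right hp.pos ((exists_elementBreadth_eq_breadth p G).2 g)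

theorem index_centralizer_finset_le {p : ℕ} (hp : p.Prime) {G : Type*} [Group G] [Finite G]
    (hG : IsPGroup p G) (T : Finset G) :
    (centralizer (T : Set G)).index ≤ p ^ (breadth p G * T.card) := by
  classical
  induction T using Finset.induction_on with
  | empty =>
    have h : centralizer ((∅ : Finset G) : Set G) = ⊤ := by
      ext x
      simp [mem_centralizer_iff]
    rw [h]
    simp
  | insert a T ha ih =>
    have h : centralizer ((insert a T : Finset G) : Set G)
        = centralizer {a} ⊓ centralizer (T : Set G) := by
      ext x
      simp [mem_centralizer_iff]
    rw [h, Finset.card_insert_of_notMem ha, mul_add_one, add_comm, pow_add]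
    exact index_inf_le.trans (Nat.mul_le_mul (index_centralizer_singleton_le hp hG a) ih)

/-- If `g` has the largest conjugacy class in `G`, and `H` acts transitively on this class, then
every commutator of an element centralizing `H` lies in any subgroup containing `g` and `H`. -/
theorem conj_mul_inv_mem_of_maximal_class {G : Type*} [Group G] [Finite G] {g : G}
    {H K : Subgroup G}
    (hmax : ∀ x : G, (centralizer {x}).index ≤ (centralizer {g}).index)
    (hH : ∀ x : G, ∃ h ∈ H, ∃ c ∈ centralizer {g}, x = h * c)
    (hHK : H ≤ K) (hgK : g ∈ K) {d : G} (hd : ∀ h ∈ H, h * d = d * h) (y : G) :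
    y * d * y⁻¹ * d⁻¹ ∈ K := by
  have hconj : ∀ x : G, ∃ h ∈ H, x * g * x⁻¹ = h * g * h⁻¹ := by
    intro x
    obtain ⟨h, hh, c, hc, rfl⟩ := hH x
    refine ⟨h, hh, ?_⟩
    have hcg : c * g = g * c := (mem_centralizer_singleton_iff.1 hc)
    calc h * c * g * (h * c)⁻¹ = h * (c * g) * c⁻¹ * h⁻¹ := by group
      _ = h * g * h⁻¹ := by rw [hcg]; group
  have hK : ∀ x : G, x * g * x⁻¹ ∈ K := by
    intro x
    obtain ⟨h, hh, e⟩ := hconj x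
    rw [e]
    exact mul_mem (mul_mem (hHK hh) hgK) (inv_mem (hHK hh))
  have hsub : (fun a => a * d) '' (Set.range fun y : G => y * g * y⁻¹)
      ⊆ Set.range fun y : G => y * (g * d) * y⁻¹ := by
    rintro _ ⟨_, ⟨x, rfl⟩, rfl⟩
    obtain ⟨h, hh, e⟩ := hconj x
    refine ⟨h, ?_⟩
    have hdh : d * h⁻¹ = h⁻¹ * d := (hd _ (inv_mem hh)).symm
    calc h * (g * d) * h⁻¹ = h * g * (d * h⁻¹) := by group
      _ = h * g * h⁻¹ * d := by rw [hdh]; group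
      _ = x * g * x⁻¹ * d := by rw [e]
  -- Maximality of the class of `g` turns the inclusion into equality.
  have heq := Set.eq_of_subset_of_ncard_le hsub (by
    rw [Set.ncard_image_of_injective _ (mul_left_injective d), ncard_conj_eq_index_centralizer,
      ncard_conj_eq_index_centralizer]
    exact hmax _)
  have hy : y * (g * d) * y⁻¹ ∈ Set.range fun y : G => y * (g * d) * y⁻¹ := ⟨y, rfl⟩
  rw [← heq] at hy
  obtain ⟨_, ⟨x, rfl⟩, hx⟩ := hy
  have key : y * d * y⁻¹ * d⁻¹ = (y * g * y⁻¹)⁻¹ * (x * g * x⁻¹) := by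
    calc y * d * y⁻¹ * d⁻¹ = (y * g * y⁻¹)⁻¹ * (y * (g * d) * y⁻¹) * d⁻¹ := by group
      _ = (y * g * y⁻¹)⁻¹ * (x * g * x⁻¹) := by rw [← hx]; group
  rw [key]
  exact mul_mem (inv_mem (hK y)) (hK x)

/-- If `G = L D` and all commutators with elements of `D` lie in `L`, then `G' ≤ L`. -/
theorem commutator_le_of_conj_mul_inv_mem {G : Type*} [Group G] {L D : Subgroup G}
    (hLD : ∀ x : G, ∃ l ∈ L, ∃ d ∈ D, x = l * d)
    (hD : ∀ d ∈ D, ∀ y : G, y * d * y⁻¹ * d⁻¹ ∈ L) : _root_.commutator G ≤ L := by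
  have hN : L.Normal := by
    refine ⟨fun n hn x => ?_⟩
    obtain ⟨l, hl, d, hd, rfl⟩ := hLD x
    have key : l * d * n * (l * d)⁻¹ = l * (n * (n⁻¹ * d * n⁻¹⁻¹ * d⁻¹)) * l⁻¹ := by group
    rw [key]
    exact mul_mem (mul_mem hl (mul_mem hn (hD d hd n⁻¹))) (inv_mem hl)
  rw [_root_.commutator_def, commutator_le]
  intro y _ x _
  obtain ⟨l, hl, d, hd, rfl⟩ := hLD x
  have key : ⁅y, l * d⁆ = (y * l * y⁻¹) * (y * d * y⁻¹ * d⁻¹) * l⁻¹ := by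
    rw [commutatorElement_def]; group
  rw [key]
  exact mul_mem (mul_mem (hN.conj_mem l hl y) (hD d hd y)) (inv_mem hl)

/-- The commutator subgroup of a finite `p`-group of breadth `b` is contained in a subgroup
generated by at most `b ^ 2 + b + 1` elements. -/
theorem exists_finset_commutator_le_closure {p : ℕ} (hp : p.Prime) {G : Type*} [Group G]
    [Finite G] (hG : IsPGroup p G) :
    ∃ T : Finset G, T.card ≤ breadth p G ^ 2 + breadth p G + 1 ∧
      _root_.commutator G ≤ closure (T : Set G) := by
  classical
  have : Fact p.Prime := ⟨hp⟩
  obtain ⟨g, hg⟩ := (exists_elementBreadth_eq_breadth p G).1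
  have hgi : (centralizer {g}).index = p ^ breadth p G := by rw [← pow_elementBreadth hp hG, hg]
  obtain ⟨T, hT, hTg⟩ := hG.exists_finset_closure_mul_eq_univ (centralizer {g})
  obtain ⟨S, hS, hSD⟩ := hG.exists_finset_closure_mul_eq_univ (centralizer (T : Set G))
  rw [hgi, Nat.pow_le_pow_iff_right hp.one_lt] at hT
  have hS' := (Nat.pow_le_pow_iff_right hp.one_lt).1
    (hS.trans (index_centralizer_finset_le hp hG T))
  refine ⟨insert g (T ∪ S), ?_, ?_⟩
  · have h1 := Finset.card_insert_le g (T ∪ S)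
    have h2 := Finset.card_union_le T S
    nlinarith [Nat.mul_le_mul_left (breadth p G) hT]
  · refine commutator_le_of_conj_mul_inv_mem (D := centralizer (T : Set G)) (fun x => ?_)
      fun d hd y => conj_mul_inv_mem_of_maximal_class (H := closure (T : Set G)) (g := g)
        (fun x => hgi ▸ index_centralizer_singleton_le hp hG x) hTg
        (closure_mono fun x hx => by simp_all) (subset_closure (by simp)) ?_ y
    · obtain ⟨h, hh, d, hd, e⟩ := hSD x
      exact ⟨h, closure_mono (fun x hx => by simp_all) hh, d, hd, e⟩
    · rw [← centralizer_closure] at hd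
      exact mem_centralizer_iff.1 hd

theorem index_centralizer_commutator_le {p : ℕ} (hp : p.Prime) {G : Type*} [Group G]
    [Finite G] (hG : IsPGroup p G) :
    (centralizer (_root_.commutator G : Set G)).index ≤
      p ^ (breadth p G * (breadth p G ^ 2 + breadth p G + 1)) := by
  obtain ⟨T, hT, hle⟩ := exists_finset_commutator_le_closure hp hG
  have h : centralizer (T : Set G) ≤ centralizer (_root_.commutator G : Set G) := by
    rw [← centralizer_closure]
    exact centralizer_le hle
  calc _ ≤ (centralizer (T : Set G)).index :=
        Nat.le_of_dvd (Nat.pos_of_ne_zero index_ne_zero_of_finite) (index_dvd_of_le h)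
    _ ≤ p ^ (breadth p G * T.card) := index_centralizer_finset_le hp hG T
    _ ≤ _ := Nat.pow_le_pow_right hp.pos (Nat.mul_le_mul_left _ hT)

/-- The centralizer of the commutator subgroup has class at most two. -/
theorem lowerCentralSeries_centralizer_commutator {G : Type*} [Group G] :
    (⊤ : Subgroup (centralizer (_root_.commutator G : Set G))).lowerCentralSeries 2 = ⊥ := by
  refine Subgroup.lowerCentralSeries_succ_eq_bot _ ?_
  rw [top_lowerCentralSeries_one,
    _root_.commutator_def (centralizer (_root_.commutator G : Set G)), commutator_le]
  intro x _ y _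
  rw [mem_center_iff]
  intro z
  have hc : ⁅(x : G), (y : G)⁆ ∈ _root_.commutator G := commutator_mem_commutator trivial trivial
  exact Subtype.ext (mem_centralizer_iff.1 z.2 _ hc).symm

theorem isMulCommutative_of_breadth_eq_zero {p : ℕ} (hp : p.Prime) {G : Type*} [Group G]
    [Finite G] (hG : IsPGroup p G) (h : breadth p G = 0) : IsMulCommutative G := by
  refine ⟨⟨fun x y => ?_⟩⟩
  have hle := index_centralizer_singleton_le hp hG y
  rw [h, pow_zero] at hle
  have htop : centralizer {y} = ⊤ := index_eq_one.1
    (le_antisymm hle (Nat.pos_of_ne_zero index_ne_zero_of_finite))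
  exact mem_centralizer_singleton_iff.1 (htop ▸ mem_top x)

theorem nilpotencyClass_centralizer_commutator_le {p : ℕ} (hp : p.Prime) {G : Type*} [Group G]
    [Finite G] (hG : IsPGroup p G) :
    Group.nilpotencyClass (centralizer (_root_.commutator G : Set G)) ≤
      breadth p (centralizer (_root_.commutator G : Set G)) + 1 := by
  have : Fact p.Prime := ⟨hp⟩
  have hN : IsPGroup p (centralizer (_root_.commutator G : Set G)) := hG.to_subgroup _
  have hnil : Group.IsNilpotent (centralizer (_root_.commutator G : Set G)) := hN.isNilpotent
  -- Class at most 2 suffices unless the breadth is 0, when the group is abelian.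
  rcases Nat.eq_zero_or_pos (breadth p (centralizer (_root_.commutator G : Set G))) with h | h
  · rw [h, zero_add, Group.IsNilpotent.nilpotencyClass_le_one_iff]
    exact isMulCommutative_of_breadth_eq_zero hp hN h
  · have h2 := Subgroup.lowerCentralSeries_eq_bot_iff_nilpotencyClass_le.1
      (lowerCentralSeries_centralizer_commutator (G := G))
    omega

theorem le_iterate_mul_add_one (k : ℕ) {x : ℝ} (hx : 0 ≤ x) :
    x ≤ (fun x : ℝ => x * (x + 1))^[k] x := by
  induction k generalizing x with
  | zero => simp
  | succ k ih =>
    rw [Function.iterate_succ_apply]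
    exact le_trans (by nlinarith) (ih (by positivity))

theorem theorem5 (p : ℕ) (hp : p.Prime) (hp2 : 2 < p)
    (G : Type*) [Group G] [Finite G] [Nontrivial G] (hG : IsPGroup p G) :
    ∃ N : Subgroup G, N.Characteristic ∧
      Real.logb 2 (N.index : ℝ) ≤
        ((breadth p G : ℝ) + 2) *
          (fun x : ℝ => x * (x + 1))^[breadth p G + 1] ((breadth p G : ℝ) * Real.logb 2 (p : ℝ)) ∧
      Group.nilpotencyClass N ≤ breadth p N + 1 := by
  refine ⟨centralizer (_root_.commutator G : Set G), inferInstance, ?_,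
    nilpotencyClass_centralizer_commutator_le hp hG⟩
  set b := breadth p G
  set l := Real.logb 2 (p : ℝ)
  have hl : 1 ≤ l := by
    rw [Real.le_logb_iff_rpow_le one_lt_two (by exact_mod_cast hp.pos), Real.rpow_one]
    exact_mod_cast hp.two_le
  have hb : (0 : ℝ) ≤ b := b.cast_nonneg
  have hbl : (b : ℝ) ≤ b * l := le_mul_of_one_le_right hb hl
  have hidx : Real.logb 2 ((centralizer (_root_.commutator G : Set G)).index : ℝ)
      ≤ (b * l) * ((b : ℝ) ^ 2 + b + 1) := by
    calc _ ≤ Real.logb 2 ((p : ℝ) ^ (b * (b ^ 2 + b + 1))) := by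
          refine Real.logb_le_logb_of_le one_lt_two ?_ ?_
          · exact_mod_cast Nat.pos_of_ne_zero index_ne_zero_of_finite
          · exact_mod_cast index_centralizer_commutator_le hp hG
      _ = _ := by
          rw [Real.logb_pow]
          push_cast
          ring
  -- One application of `f` is enough; the other `b` only increase the bound.
  have hiter : (b * l) * (b * l + 1) ≤ (fun x : ℝ => x * (x + 1))^[b + 1] (b * l) := by
    rw [Function.iterate_succ_apply]
    exact le_iterate_mul_add_one b (by positivity)
  calc _ ≤ (b * l) * ((b : ℝ) ^ 2 + b + 1) := hidx
    _ ≤ (b * l) * ((b + 2) * (b * l + 1)) :=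
        mul_le_mul_of_nonneg_left (by nlinarith) (by positivity)
    _ = (b + 2) * ((b * l) * (b * l + 1)) := by ring
    _ ≤ _ := mul_le_mul_of_nonneg_left hiter (by positivity)
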